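/- Let $A$ be a partial combinatory algebra (pca), that is, a set $A$ with a partial binary operation $(a,b)\mapsto a\cdot b$ for which there exist $k,s\in A$ such that for all $a,b,c\in A$: $k\cdot a$ is defined and $(k\cdot a)\cdot b\simeq a$; $s\cdot a$ and $(s\cdot a)\cdot b$ are defined and $((s\cdot a)\cdot b)\cdot c\simeq(a\cdot c)\cdot(b\cdot c)$, where $\simeq$ means that one side is defined if and only if the other is, and then they are equal. Let $\mathrm{Asm}(A)$ be the category of assemblies on $A$: its objects are pairs $(X,E)$ of a set $X$ and a function $E$ assigning to each $x\in X$ a non-empty subset $E(x)\subseteq A$; a morphism $(X,E)\to(Y,F)$ is a function $f:X\to Y$ for which there is $a\in A$ such that for all $x\in X$ and $b\in E(x)$, $a\cdot b$ is defined and $a\cdot b\in F(f(x))$. Let $\mathrm{PAsm}(A)$ be the full subcategory of partitioned assemblies, those $(X,E)$ for which every $E(x)$ is a singleton. For a category $\mathcal D$ with finite limits, its reg/lex completion $\mathcal D_{\mathrm{reg/lex}}$ is the category whose objects are the arrows of $\mathcal D$, and in which an arrow from $g:X\to Y$ to $f:U\to V$ is an equivalence class of arrows $m:X\to U$ with $f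 m g_1=f m g_2$, where $g_1,g_2$ is a kernel pair of $g$, two such arrows $m,n$ being equivalent if $f m=f n$; identities and composition are induced by those of $\mathcal D$. Then $\mathrm{PAsm}(A)$ has finite limits, and there is an equivalence of categories $$\mathrm{Asm}(A)\;\simeq\;\mathrm{PAsm}(A)_{\mathrm{reg/lex}}.$$ -/

import Mathlib

open CategoryTheory CategoryTheory.Limits

universe u v

/-- A partial combinatory algebra: a set `A` with a partial binary operation `app` for which
there exist elements `k` and `s` such that, for all `a b c`,
`k·a↓` and `(k·a)·b ≃ a`; `s·a↓`, `(s·a)·b↓` and `((s·a)·b)·c ≃ (a·c)·(b·c)`.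
Values are taken in `Part A`, so that equality in `Part A` is Kleene equality: one side is
defined if and only if the other is, and then they are equal. -/
class PartialCombinatoryAlgebra (A : Type u) where
  app : A → A → Part A
  exists_k_s : ∃ k s : A,
    (∀ a b : A, (app k a).Dom ∧ ((app k a).bind fun ka => app ka b) = Part.some a) ∧
    (∀ a b c : A, (app s a).Dom ∧ ((app s a).bind fun sa => app sa b).Dom ∧
      (((app s a).bind fun sa => app sa b).bind fun sab => app sab c) =
        ((app a c).bind fun ac => (app b c).bind fun bc => app ac bc))

namespace PartialCombinatoryAlgebra

variable {A : Type u} [PartialCombinatoryAlgebra A]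

/-- There is an identity element `s·k·k`. -/
theorem exists_id : ∃ i : A, ∀ a : A, a ∈ app i a := by
  obtain ⟨k, s, hk, hs⟩ := exists_k_s (A := A)
  obtain ⟨-, h2, -⟩ := hs k k k
  refine ⟨Part.get _ h2, fun a => ?_⟩
  obtain ⟨-, -, h3⟩ := hs k k a
  have e : ((app s k).bind fun sa => app sa k) = Part.some (Part.get _ h2) :=
    (Part.some_get h2).symm
  rw [e, Part.bind_some] at h3
  rw [h3]
  obtain ⟨ka, e2⟩ : ∃ v, app k a = Part.some v := ⟨_, (Part.some_get (hk a a).1).symm⟩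
  obtain ⟨-, h4⟩ := hk a ka
  rw [e2, Part.bind_some] at h4
  rw [e2, Part.bind_some, Part.bind_some, h4]
  exact Part.mem_some a

/-- There is an element `s·(k·b)·a` that computes `x ↦ b·(a·x)`. -/
theorem exists_comp (a b : A) :
    ∃ c : A, ∀ x y z : A, y ∈ app a x → z ∈ app b y → z ∈ app c x := by
  obtain ⟨k, s, hk, hs⟩ := exists_k_s (A := A)
  obtain ⟨kb, e1⟩ : ∃ v, app k b = Part.some v := ⟨_, (Part.some_get (hk b b).1).symm⟩
  obtain ⟨-, h2, -⟩ := hs kb a a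
  refine ⟨Part.get _ h2, fun x y z hy hz => ?_⟩
  obtain ⟨-, -, h3⟩ := hs kb a x
  have e : ((app s kb).bind fun sa => app sa a) = Part.some (Part.get _ h2) :=
    (Part.some_get h2).symm
  rw [e, Part.bind_some] at h3
  obtain ⟨-, h4⟩ := hk b x
  rw [e1, Part.bind_some] at h4
  rw [h3, h4, Part.bind_some, Part.eq_some_iff.2 hy, Part.bind_some]
  exact hz

end PartialCombinatoryAlgebra

/-- An assembly on `A`: a set `X` with a function `E` from `X` to the non-empty subsets
of `A`. -/
structure Assembly (A : Type u) [PartialCombinatoryAlgebra A] where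
  carrier : Type u
  E : carrier → Set A
  nonempty_E : ∀ x, (E x).Nonempty

namespace Assembly

open PartialCombinatoryAlgebra

variable {A : Type u} [PartialCombinatoryAlgebra A]

/-- The element `a` tracks the function `f`: for all `x` and `b ∈ E x`, `a·b` is defined and
belongs to `E (f x)`. -/
def Tracks {X Y : Assembly A} (a : A) (f : X.carrier → Y.carrier) : Prop :=
  ∀ x, ∀ b ∈ X.E x, ∃ c ∈ app a b, c ∈ Y.E (f x)

/-- A morphism of assemblies is a function that is tracked by some element of `A`. -/
@[ext]
structure Hom (X Y : Assembly A) where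
  toFun : X.carrier → Y.carrier
  exists_tracks : ∃ a : A, Tracks a toFun

/-- The category of assemblies on `A`. -/
instance : Category (Assembly A) where
  Hom := Hom
  id X := ⟨id, by
    obtain ⟨i, hi⟩ := exists_id (A := A)
    exact ⟨i, fun x b hb => ⟨b, hi b, hb⟩⟩⟩
  comp f g := ⟨g.toFun ∘ f.toFun, by
    obtain ⟨a, ha⟩ := f.exists_tracks
    obtain ⟨b, hb⟩ := g.exists_tracks
    obtain ⟨c, hc⟩ := exists_comp a b
    refine ⟨c, fun x d hd => ?_⟩
    obtain ⟨y, hy, hy'⟩ := ha x d hd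
    obtain ⟨z, hz, hz'⟩ := hb _ y hy'
    exact ⟨z, hc d y z hy hz, hz'⟩⟩

/-- An assembly is partitioned if `E` is single-valued. -/
def IsPartitioned : ObjectProperty (Assembly A) :=
  fun X => ∀ x, ∃ a : A, X.E x = {a}

end Assembly

/-- The category of partitioned assemblies: the full subcategory of the category of assemblies
on the partitioned ones. -/
abbrev PartitionedAssembly (A : Type u) [PartialCombinatoryAlgebra A] :=
  (Assembly.IsPartitioned (A := A)).FullSubcategory

/-- The objects of the reg/lex completion of a category `D` with finite limits: the arrows
of `D`. -/
structure RegLex (D : Type u) [Category.{v} D] [HasFiniteLimits D] where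
  {src : D}
  {tgt : D}
  arrow : src ⟶ tgt

namespace RegLex

variable {D : Type u} [Category.{v} D] [HasFiniteLimits D]

/-- The representatives of the arrows from `g : X ⟶ Y` to `f : U ⟶ V` in the reg/lex completion:
the arrows `m : X ⟶ U` such that `f ∘ m` coequalizes the kernel pair of `g`. -/
def PreHom (g f : RegLex D) : Type v :=
  { m : g.src ⟶ f.src //
    pullback.fst g.arrow g.arrow ≫ m ≫ f.arrow = pullback.snd g.arrow g.arrow ≫ m ≫ f.arrow }

/-- Two representatives `m` and `n` are identified if `f ∘ m = f ∘ n`. -/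
def homSetoid (g f : RegLex D) : Setoid (PreHom g f) where
  r m n := m.1 ≫ f.arrow = n.1 ≫ f.arrow
  iseqv := ⟨fun _ => rfl, fun h => h.symm, fun h₁ h₂ => h₁.trans h₂⟩

theorem PreHom.comp_eq {f h : RegLex D} (n : PreHom f h) {W : D} {a b : W ⟶ f.src}
    (w : a ≫ f.arrow = b ≫ f.arrow) : a ≫ n.1 ≫ h.arrow = b ≫ n.1 ≫ h.arrow := by
  have := pullback.lift a b w ≫= n.2
  rwa [pullback.lift_fst_assoc, pullback.lift_snd_assoc] at this

/-- Composition of representatives. -/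
def PreHom.comp {g f h : RegLex D} (m : PreHom g f) (n : PreHom f h) : PreHom g h :=
  ⟨m.1 ≫ n.1, by
    have := n.comp_eq (a := pullback.fst g.arrow g.arrow ≫ m.1)
      (b := pullback.snd g.arrow g.arrow ≫ m.1) (by simpa using m.2)
    simpa using this⟩

/-- The reg/lex completion of a category with finite limits, with composition and identities
induced by those of `D`. -/
instance : Category.{v} (RegLex D) where
  Hom g f := Quotient (homSetoid g f)
  id g := Quotient.mk _ ⟨𝟙 g.src, by simpa using pullback.condition⟩
  comp {g f h} := Quotient.map₂ (sa := homSetoid g f) (sb := homSetoid f h) (sc := homSetoid g h)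
    PreHom.comp (by
      intro m m' hm n n' hn
      change (m.1 ≫ n.1) ≫ h.arrow = (m'.1 ≫ n'.1) ≫ h.arrow
      have h1 : n.1 ≫ h.arrow = n'.1 ≫ h.arrow := hn
      rw [Category.assoc, Category.assoc, ← h1]
      exact n.comp_eq hm)
  id_comp := by
    rintro g f ⟨m⟩
    exact congrArg (Quotient.mk _) (Subtype.ext (Category.id_comp m.1))
  comp_id := by
    rintro g f ⟨m⟩
    exact congrArg (Quotient.mk _) (Subtype.ext (Category.comp_id m.1))
  assoc := by
    rintro g f h l ⟨m⟩ ⟨n⟩ ⟨p⟩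
    exact congrArg (Quotient.mk _) (Subtype.ext (Category.assoc m.1 n.1 p.1))

end RegLex

/-! Send an arrow `g` of partitioned assemblies to its image in assemblies: the range of `g`, a
point being realized by the realizers of all its preimages. The kernel pair condition says exactly
that a representative `m` descends to images, and two representatives descend to the same map iff
they are identified, so this is a faithful functor. It is full because a point of a partitioned
assembly has only one realizer, so a tracker of a map of images selects preimages computably. It is
essentially surjective because every assembly `X` is the image of the pairs (point, realizer).
Finite limits come from a pairing on `A`. -/

namespace PartialCombinatoryAlgebra

variable {A : Type u} [PartialCombinatoryAlgebra A]

/-- Every element of `A` is the value of a constant function that is computed by an element. -/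
theorem exists_const (a : A) : ∃ c : A, ∀ x : A, a ∈ app c x := by
  obtain ⟨k, s, hk, -⟩ := exists_k_s (A := A)
  obtain ⟨c, hc⟩ : ∃ c, app k a = Part.some c := ⟨_, (Part.some_get (hk a a).1).symm⟩
  refine ⟨c, fun x => ?_⟩
  have h := (hk a x).2
  rw [hc, Part.bind_some] at h
  exact Part.eq_some_iff.1 h

/-- There is an element `k` such that `k·a` computes the constant function with value `a`. -/
theorem exists_constants :
    ∃ (k : A) (K : A → A), (∀ a, K a ∈ app k a) ∧ ∀ a x, a ∈ app (K a) x := by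
  obtain ⟨k, s, hk, -⟩ := exists_k_s (A := A)
  choose K hK using fun a : A => Part.dom_iff_mem.1 (hk a a).1
  refine ⟨k, K, hK, fun a x => ?_⟩
  have h := (hk a x).2
  rw [Part.eq_some_iff.2 (hK a), Part.bind_some] at h
  exact Part.eq_some_iff.1 h

/-- There is an element `s` such that `s·a·b` computes `x ↦ (a·x)·(b·x)`. -/
theorem exists_substitution :
    ∃ (s : A) (S : A → A) (T : A → A → A), (∀ a, S a ∈ app s a) ∧
      (∀ a b, T a b ∈ app (S a) b) ∧
      ∀ a b x y z w, y ∈ app a x → z ∈ app b x → w ∈ app y z → w ∈ app (T a b) x := by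
  obtain ⟨k, s, -, hs⟩ := exists_k_s (A := A)
  choose S hS using fun a : A => Part.dom_iff_mem.1 (hs a a a).1
  have hS' (a : A) : app s a = Part.some (S a) := Part.eq_some_iff.2 (hS a)
  choose T hT using fun a b : A => Part.dom_iff_mem.1 (hs a b b).2.1
  simp only [hS', Part.bind_some] at hT
  refine ⟨s, S, T, hS, hT, fun a b x y z w hy hz hw => ?_⟩
  have h := (hs a b x).2.2
  rw [hS', Part.bind_some, Part.eq_some_iff.2 (hT a b), Part.bind_some, Part.eq_some_iff.2 hy,
    Part.bind_some, Part.eq_some_iff.2 hz, Part.bind_some] at h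
  rwa [h]

/-- There is a pairing on `A` with computable projections, such that the pairing of two
computable functions is computable. -/
theorem exists_pairing :
    ∃ (pair : A → A → A) (p q : A), (∀ a b, a ∈ app p (pair a b)) ∧
      (∀ a b, b ∈ app q (pair a b)) ∧
      ∀ a b : A, ∃ c : A, ∀ x y z, y ∈ app a x → z ∈ app b x → pair y z ∈ app c x := by
  obtain ⟨i, hi⟩ := exists_id (A := A)
  obtain ⟨k, K, hk, hK⟩ := exists_constants (A := A)
  obtain ⟨s, S, T, hS, hST, hT⟩ := exists_substitution (A := A)
  -- `pair a b` computes `z ↦ (z·a)·b`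
  have key : ∀ a b z u v : A, u ∈ app z a → v ∈ app u b →
      v ∈ app (T (T i (K a)) (K b)) z := fun a b z u v hu hv =>
    hT _ _ z u b v (hT _ _ z z a u (hi z) (hK a z) hu) (hK b z) hv
  -- The projections evaluate at `k` and at `k·i`, since `(k·a)·b = a` and `((k·i)·a)·b = i·b = b`.
  refine ⟨fun a b => T (T i (K a)) (K b), T i (K k), T i (K (K i)), fun a b => ?_,
    fun a b => ?_, fun a b => ?_⟩
  · exact hT _ _ _ _ k a (hi _) (hK k _) (key a b k (K a) a (hk a) (hK a b))
  · exact hT _ _ _ _ (K i) b (hi _) (hK (K i) _) (key a b (K i) i b (hK i a) (hi b))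
  -- `d` computes `x ↦ s·(s·i·(k·(a·x)))` and `kb` computes `x ↦ k·(b·x)`; applying the first value
  -- to the second gives the pair.
  · obtain ⟨ka, hka⟩ := exists_comp a k
    obtain ⟨kb, hkb⟩ := exists_comp b k
    obtain ⟨c, hc⟩ := exists_comp ka (S i)
    obtain ⟨d, hd⟩ := exists_comp c s
    refine ⟨T d kb, fun x y z hy hz => ?_⟩
    exact hT d kb x _ _ _
      (hd x _ _ (hc x _ _ (hka x _ _ hy (hk y)) (hST i (K y))) (hS _))
      (hkb x _ _ hz (hk z)) (hST _ _)

end PartialCombinatoryAlgebra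

open PartialCombinatoryAlgebra

/-! ### Partitioned assemblies and their finite limits -/

namespace PartitionedAssembly

variable {A : Type u} [PartialCombinatoryAlgebra A]

/-- The partitioned assembly on `X` in which `x` is realized by `r x` only. -/
def of (X : Type u) (r : X → A) : PartitionedAssembly A :=
  ⟨⟨X, fun x => {r x}, fun x => ⟨r x, rfl⟩⟩, fun x => ⟨r x, rfl⟩⟩

/-- The unique realizer of an element of a partitioned assembly. -/
noncomputable def realizer (X : PartitionedAssembly A) (x : X.obj.carrier) : A :=
  (X.property x).choose

theorem E_eq (X : PartitionedAssembly A) (x : X.obj.carrier) : X.obj.E x = {realizer X x} :=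
  (X.property x).choose_spec

/-- The function underlying a morphism of partitioned assemblies. -/
def fn {X Y : PartitionedAssembly A} (f : X ⟶ Y) : X.obj.carrier → Y.obj.carrier :=
  Assembly.Hom.toFun f.hom

/-- The morphism of partitioned assemblies given by a tracked function. -/
def mk {X Y : PartitionedAssembly A} (f : X.obj.carrier → Y.obj.carrier)
    (hf : ∃ a : A, Assembly.Tracks a f) : X ⟶ Y :=
  ObjectProperty.homMk ⟨f, hf⟩

theorem fn_comp {X Y Z : PartitionedAssembly A} (f : X ⟶ Y) (g : Y ⟶ Z)
    (x : X.obj.carrier) : fn (f ≫ g) x = fn g (fn f x) := rfl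

theorem hom_ext {X Y : PartitionedAssembly A} {f g : X ⟶ Y} (h : ∀ x, fn f x = fn g x) :
    f = g :=
  ObjectProperty.hom_ext _ (Assembly.Hom.ext (funext h))

theorem exists_tracks {X Y : PartitionedAssembly A} (f : X ⟶ Y) :
    ∃ a : A, ∀ x, realizer Y (fn f x) ∈ app a (realizer X x) := by
  obtain ⟨a, ha⟩ := Assembly.Hom.exists_tracks f.hom
  refine ⟨a, fun x => ?_⟩
  obtain ⟨c, hc, hc'⟩ := ha x (realizer X x) (by rw [E_eq]; rfl)
  change c ∈ Y.obj.E (fn f x) at hc'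
  rw [E_eq, Set.mem_singleton_iff] at hc'
  exact hc' ▸ hc

/-- The partitioned assembly with one element. -/
def point (a : A) : PartitionedAssembly A := of PUnit fun _ => a

theorem exists_tracks_const {X Y : Assembly A} (y : Y.carrier) :
    ∃ a : A, Assembly.Tracks (X := X) (Y := Y) a fun _ => y := by
  obtain ⟨b, hb⟩ := Y.nonempty_E y
  obtain ⟨c, hc⟩ := exists_const b
  exact ⟨c, fun _ d _ => ⟨b, hc d, hb⟩⟩

theorem hasTerminal : HasTerminal (PartitionedAssembly A) := by
  obtain ⟨i, -⟩ := exists_id (A := A)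
  refine IsTerminal.hasTerminal (X := point i) (IsTerminal.ofUniqueHom
    (fun X => mk (fun _ => PUnit.unit) (exists_tracks_const _)) fun X f => ?_)
  exact hom_ext fun _ => rfl

/-- The pullback of sets works, each compatible pair being realized by the pair of the two
realizers. -/
theorem hasPullbacks : HasPullbacks (PartitionedAssembly A) := by
  obtain ⟨pair, p, q, hp, hq, hpair⟩ := exists_pairing (A := A)
  refine @hasPullbacks_of_hasLimit_cospan _ _ fun {X Y Z} f g => ?_
  let P : PartitionedAssembly A := of { w : X.obj.carrier × Y.obj.carrier // fn f w.1 = fn g w.2 }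
    fun w => pair (realizer X w.1.1) (realizer Y w.1.2)
  let π₁ : P ⟶ X := mk (fun w => w.1.1) ⟨p, by
    rintro w _ rfl
    exact ⟨_, hp _ _, by rw [E_eq]; rfl⟩⟩
  let π₂ : P ⟶ Y := mk (fun w => w.1.2) ⟨q, by
    rintro w _ rfl
    exact ⟨_, hq _ _, by rw [E_eq]; rfl⟩⟩
  have w : π₁ ≫ f = π₂ ≫ g := hom_ext fun x => x.2
  have hs (s : PullbackCone f g) (x : s.pt.obj.carrier) :
      fn f (fn s.fst x) = fn g (fn s.snd x) := by
    rw [← fn_comp, ← fn_comp, s.condition]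
  refine ⟨⟨⟨_, PullbackCone.IsLimit.mk w
    (fun s => mk (fun x => ⟨(fn s.fst x, fn s.snd x), hs s x⟩) ?_) (fun s => rfl) (fun s => rfl)
    fun s m h₁ h₂ => hom_ext fun x => Subtype.ext (Prod.ext ?_ ?_)⟩⟩⟩
  · obtain ⟨a, ha⟩ := exists_tracks s.fst
    obtain ⟨b, hb⟩ := exists_tracks s.snd
    obtain ⟨c, hc⟩ := hpair a b
    refine ⟨c, fun x d hd => ?_⟩
    rw [E_eq, Set.mem_singleton_iff] at hd
    exact ⟨_, hd ▸ hc _ _ _ (ha x) (hb x), rfl⟩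
  · exact congrArg (fun e => fn e x) h₁
  · exact congrArg (fun e => fn e x) h₂

instance : HasFiniteLimits (PartitionedAssembly A) :=
  have := hasTerminal (A := A)
  have := hasPullbacks (A := A)
  hasFiniteLimits_of_hasTerminal_and_pullbacks

/-! ### The image functor -/

/-- A representative of an arrow of the reg/lex completion respects the equivalence relations
induced by its source and target. -/
theorem fn_eq_of_preHom {g f : RegLex (PartitionedAssembly A)} (m : RegLex.PreHom g f)
    {x y : g.src.obj.carrier} (h : fn g.arrow x = fn g.arrow y) :
    fn f.arrow (fn m.1 x) = fn f.arrow (fn m.1 y) := by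
  obtain ⟨i, -⟩ := exists_id (A := A)
  -- Global points are tracked by constants, so `x` and `y` together factor through the kernel pair
  -- of `g`.
  let pt (z : g.src.obj.carrier) : point i ⟶ g.src := mk (fun _ => z) (exists_tracks_const z)
  have w : pt x ≫ g.arrow = pt y ≫ g.arrow := hom_ext fun _ => h
  exact congrArg (fun e => fn e PUnit.unit) (m.comp_eq w)

/-- The image of a morphism of partitioned assemblies, as an assembly: a point of the image is
realized by the realizers of all its preimages. -/
def image {X Y : PartitionedAssembly A} (g : X ⟶ Y) : Assembly A where
  carrier := Set.range (fn g)
  E y := { a | ∃ x, fn g x = y.1 ∧ a ∈ X.obj.E x }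
  nonempty_E := by
    rintro ⟨_, x, rfl⟩
    obtain ⟨a, ha⟩ := X.obj.nonempty_E x
    exact ⟨a, x, rfl, ha⟩

/-- The morphism between images induced by a representative. -/
noncomputable def imageMap {g f : RegLex (PartitionedAssembly A)} (m : RegLex.PreHom g f) :
    image g.arrow ⟶ image f.arrow :=
  Assembly.Hom.mk (fun y => ⟨fn f.arrow (fn m.1 y.2.choose), _, rfl⟩) <| by
    obtain ⟨a, ha⟩ := Assembly.Hom.exists_tracks m.1.hom
    refine ⟨a, ?_⟩
    rintro y b ⟨x, hx, hb⟩
    obtain ⟨c, hc, hc'⟩ := ha x b hb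
    exact ⟨c, hc, fn m.1 x, fn_eq_of_preHom m (hx.trans y.2.choose_spec.symm), hc'⟩

/-- The preimage chosen in `imageMap` may be replaced by any other. -/
theorem imageMap_apply {g f : RegLex (PartitionedAssembly A)} (m : RegLex.PreHom g f)
    (x : g.src.obj.carrier) :
    Assembly.Hom.toFun (imageMap m) ⟨fn g.arrow x, x, rfl⟩ =
      ⟨fn f.arrow (fn m.1 x), _, rfl⟩ :=
  Subtype.ext (fn_eq_of_preHom m (Exists.choose_spec (p := fun y => fn g.arrow y = _) _))

theorem image_hom_ext {X Y : PartitionedAssembly A} {g : X ⟶ Y} {Z : Assembly A}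
    {h h' : image g ⟶ Z} (w : ∀ x, Assembly.Hom.toFun h ⟨fn g x, x, rfl⟩ =
      Assembly.Hom.toFun h' ⟨fn g x, x, rfl⟩) : h = h' :=
  Assembly.Hom.ext (funext (by rintro ⟨_, x, rfl⟩; exact w x))

theorem imageMap_eq_iff {g f : RegLex (PartitionedAssembly A)} (m n : RegLex.PreHom g f) :
    imageMap m = imageMap n ↔ m.1 ≫ f.arrow = n.1 ≫ f.arrow := by
  refine ⟨fun h => hom_ext fun x => ?_, fun h => image_hom_ext fun x => ?_⟩
  · exact congrArg Subtype.val <| (imageMap_apply m x).symm.trans <|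
      (congrArg (fun e => Assembly.Hom.toFun e (⟨fn g.arrow x, x, rfl⟩ : Set.range _)) h).trans
        (imageMap_apply n x)
  · rw [imageMap_apply, imageMap_apply]
    exact Subtype.ext (congrArg (fun e => fn e x) h)

variable (A) in
/-- The functor from the reg/lex completion of partitioned assemblies to assemblies that takes
an arrow to its image. -/
noncomputable def imageFunctor : RegLex (PartitionedAssembly A) ⥤ Assembly A where
  obj g := image g.arrow
  map {g f} := Quotient.lift (s := RegLex.homSetoid g f) imageMap
    fun m n h => (imageMap_eq_iff m n).2 h
  map_id g := image_hom_ext fun x => imageMap_apply _ x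
  map_comp := by
    rintro g f h ⟨m⟩ ⟨n⟩
    refine image_hom_ext fun x => (imageMap_apply (m.comp n) x).trans ?_
    change _ = Assembly.Hom.toFun (imageMap n) (Assembly.Hom.toFun (imageMap m) _)
    rw [imageMap_apply, imageMap_apply]
    rfl

/-! ### The image functor is an equivalence -/

instance : (imageFunctor A).Faithful where
  map_injective := by
    rintro g f ⟨m⟩ ⟨n⟩ h
    exact Quotient.sound (s := RegLex.homSetoid g f) ((imageMap_eq_iff m n).1 h)

instance : (imageFunctor A).Full where
  map_surjective := by
    intro g f h
    change image g.arrow ⟶ image f.arrow at h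
    obtain ⟨a, ha⟩ := Assembly.Hom.exists_tracks h
    -- The value of `a` at the single realizer of `x` realizes some preimage `u` of the target
    -- point. Choosing such a `u` for each `x` gives a lift of `h` that `a` still tracks.
    have key (x : g.src.obj.carrier) : ∃ u : f.src.obj.carrier,
        fn f.arrow u = (Assembly.Hom.toFun h ⟨fn g.arrow x, x, rfl⟩).1 ∧
          realizer f.src u ∈ app a (realizer g.src x) := by
      obtain ⟨c, hc, u, hu, hcu⟩ := ha ⟨fn g.arrow x, x, rfl⟩ (realizer g.src x)
        ⟨x, rfl, by rw [E_eq]; rfl⟩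
      rw [E_eq, Set.mem_singleton_iff] at hcu
      exact ⟨u, hu, hcu ▸ hc⟩
    choose m hm hma using key
    let M : g.src ⟶ f.src := mk m ⟨a, fun x b hb => by
      rw [E_eq, Set.mem_singleton_iff] at hb
      exact ⟨_, hb ▸ hma x, by rw [E_eq]; rfl⟩⟩
    have hM : pullback.fst g.arrow g.arrow ≫ M ≫ f.arrow =
        pullback.snd g.arrow g.arrow ≫ M ≫ f.arrow := hom_ext fun z => by
      have hz : fn g.arrow (fn (pullback.fst g.arrow g.arrow) z) =
          fn g.arrow (fn (pullback.snd g.arrow g.arrow) z) :=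
        congrArg (fun e => fn e z) (pullback.condition (f := g.arrow) (g := g.arrow))
      refine (hm _).trans (Eq.trans ?_ (hm _).symm)
      exact congrArg (fun y => (Assembly.Hom.toFun h y).1) (Subtype.ext hz)
    refine ⟨Quotient.mk _ ⟨M, hM⟩, image_hom_ext fun x => ?_⟩
    exact (imageMap_apply _ x).trans (Subtype.ext (hm x))

/-- The projection onto an assembly (with all its points given the same realizer) from the
partitioned assembly of its realized elements. -/
def cover (X : Assembly A) (i : A) :
    of (Σ x, X.E x) (fun w => w.2.1) ⟶ of X.carrier (fun _ => i) :=
  mk (fun w => w.1) <| by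
    obtain ⟨c, hc⟩ := exists_const i
    exact ⟨c, fun _ b _ => ⟨i, hc b, rfl⟩⟩

/-- Every assembly is the image of its cover. -/
noncomputable def imageCoverIso (X : Assembly A) (i : A) : image (cover X i) ≅ X where
  hom := Assembly.Hom.mk (fun y => y.1) <| by
    -- A point has the same realizers in the image as in `X`, so the identity element tracks both
    -- directions.
    obtain ⟨j, hj⟩ := exists_id (A := A)
    refine ⟨j, ?_⟩
    rintro ⟨_, -⟩ _ ⟨w, rfl, rfl⟩
    exact ⟨_, hj _, w.2.2⟩
  inv := Assembly.Hom.mk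
    (fun x => ⟨x, ⟨x, _, (X.nonempty_E x).choose_spec⟩, rfl⟩) <| by
    obtain ⟨j, hj⟩ := exists_id (A := A)
    exact ⟨j, fun x b hb => ⟨b, hj b, ⟨x, b, hb⟩, rfl, rfl⟩⟩
  hom_inv_id := rfl
  inv_hom_id := rfl

instance : (imageFunctor A).EssSurj where
  mem_essImage X := by
    obtain ⟨i, -⟩ := exists_id (A := A)
    exact ⟨⟨cover X i⟩, ⟨imageCoverIso X i⟩⟩

instance : (imageFunctor A).IsEquivalence where

end PartitionedAssembly

/-- For every partial combinatory algebra `A`, the category of partitioned assemblies on `A` has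
finite limits, and the category of assemblies on `A` is equivalent to its reg/lex completion. -/
theorem mainTheorem12 (A : Type u) [PartialCombinatoryAlgebra A] :
    ∃ _ : HasFiniteLimits (PartitionedAssembly A),
      Nonempty (Assembly A ≌ RegLex (PartitionedAssembly A)) :=
  ⟨inferInstance, ⟨(PartitionedAssembly.imageFunctor A).asEquivalence.symm⟩⟩
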